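/- Let $n\ge 2p\ge 2$, let $\beta\in\mathbb R^p$, $\sigma^2\ge 0$, $B\in\mathbb R$. A data set consists of a design $X\in\mathbb R^{n\times p}$ and responses $y=X\beta+w$ with $w\sim\mathcal N(0,\sigma^2I_n)$; it is assumed that $X^\top X$ is invertible, that every row of $X$ has $\ell_2$-norm at most $B$ and that every column has $\ell_2$-norm at least $B$. Two data sets are adjacent if they differ in a single observation (one row of $[X\ y]$). Let $X'$ be $X$ with its columns scaled to $\ell_2$-norm $1$, $\Sigma'=X'^\top X'$, and let $\widetilde{X'}$ be a knockoff copy of $X'$ made with $\operatorname{diag}\{s\}=\lambda_{\min}(\Sigma')I_p$, that is, $\widetilde{X'}=X'\big(I_p-\lambda_{\min}(\Sigma')\Sigma'^{-1}\big)+\widetilde U C$ with $\widetilde U\in\mathbb R^{n\times p}$, $\widetilde U^\top\widetilde U=I_p$, $\widetilde U^\top X'=0$, and $C$ the Cholesky factor of $2\lambda_{\min}(\Sigma')I_p-\lambda_{\min}(\Sigma')^2\Sigma'^{-1}$ (so $C^\top C$ equals this matrix). Let $\hat\beta'=\arg\min_{b\in\mathbb R^{2p}}\|y-[X'\ \widetilde{X'}]b\|_2^2$.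 Put $C_{\min}=\min_i\|X^{(i)}\|_2$ (minimum over the columns of $X$) and $\eta\ge 0$, $\eta^2=B^2/(C_{\min}^2-B^2)$. Let $\epsilon,\delta_1\in(0,1)$, $\delta_2>2e^{-p/2}$ and $\zeta=\dfrac{2p\sigma^2}{1-\sqrt{\frac2p\ln(2/\delta_2)}}$ (the square root being read as $0$ if $\delta_2>2$). Let the observed data set have a design $X$ with $C_{\min}>B$, $\eta<1$ and $\lambda_{\min}(\Sigma')>\eta^2/(1-\eta^2)$, put $$\Delta=\frac{2\zeta^{1/2}}{\sqrt{(1-\eta^2)\lambda_{\min}(\Sigma')-\eta^2}}+\Big(C_{\min}-\frac B\eta\Big)\|\beta\|_2 ,$$ and let $\kappa^2>\frac{2\ln(1.25/\delta_1)}{\epsilon^2}\Delta^2$ be calibrated in this way to the observed data set. Then for every data set adjacent to the observed one, with least-squares estimates $\hat\beta_2'$ and $\hat\beta_1'$ respectively: 1. $\Delta$ bounds the $\ell_2$-sensitivity: $\mathbb P\big(\|\hat\beta_1'-\hat\beta_2'\|_2\le\Delta\big)\ge 1-\delta_2$. 2. Releasing $\hat\beta'+e$, with $e\sim\mathcal N(0,\kappa^2I_{2p})$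 independent of the data, is $(\epsilon,\delta_1+\delta_2)$-differentially private at the observed data set: for every measurable $S\subseteq\mathbb R^{2p}$, $$\mathbb P(\hat\beta_1'+e\in S)\le e^{\epsilon}\,\mathbb P(\hat\beta_2'+e\in S)+\delta_1+\delta_2,$$ and the same holds with $\hat\beta_1'$ and $\hat\beta_2'$ interchanged. Probabilities are over both $w$ and $e$. -/

import Mathlib

open MeasureTheory ProbabilityTheory Matrix

noncomputable section

namespace KnockoffDP

/-- A data set: `n` observations of `p` explanatory variables (rows of `X`) with their responses. -/
structure Dataset (n p : ℕ) where
  /-- the design matrix -/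
  X : Matrix (Fin n) (Fin p) ℝ
  /-- the vector of responses -/
  y : EuclideanSpace ℝ (Fin n)

/-- Two data sets are adjacent if they differ in at most one observation, i.e. in one row
of `X` together with the corresponding response. -/
def Adjacent {n p : ℕ} (A A' : Dataset n p) : Prop :=
  ∃ i : Fin n, ∀ k : Fin n, k ≠ i → A.X k = A'.X k ∧ A.y k = A'.y k

/-- The `ℓ₂`-norm of the `i`-th row. -/
def rowNorm {n p : ℕ} (X : Matrix (Fin n) (Fin p) ℝ) (i : Fin n) : ℝ :=
  ‖(WithLp.toLp 2 (fun j => X i j) : EuclideanSpace ℝ (Fin p))‖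

/-- The `ℓ₂`-norm of the `j`-th column. -/
def colNorm {n p : ℕ} (X : Matrix (Fin n) (Fin p) ℝ) (j : Fin p) : ℝ :=
  ‖(WithLp.toLp 2 (fun i => X i j) : EuclideanSpace ℝ (Fin n))‖

/-- The Gram matrix `Σ = Xᵀ X`. -/
def gram {n p : ℕ} (X : Matrix (Fin n) (Fin p) ℝ) : Matrix (Fin p) (Fin p) ℝ :=
  Xᵀ * X

/-- The design `X'`: every column is divided by its `ℓ₂`-norm. -/
def normalize {n p : ℕ} (X : Matrix (Fin n) (Fin p) ℝ) : Matrix (Fin n) (Fin p) ℝ :=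
  Matrix.of fun i j => X i j / colNorm X j

/-- The smallest eigenvalue of a (real symmetric) matrix. -/
def lamMin {p : ℕ} (A : Matrix (Fin p) (Fin p) ℝ) : ℝ :=
  sInf (spectrum ℝ A)

/-- The design matrices under consideration: the Gram matrix is invertible, and `B` is an upper
bound for the norms of the rows and a lower bound for the norms of the columns. -/
structure Admissible {n p : ℕ} (B : ℝ) (X : Matrix (Fin n) (Fin p) ℝ) : Prop where
  isUnit_det : IsUnit (gram X).det
  row_le : ∀ i, rowNorm X i ≤ B
  le_col : ∀ j, B ≤ colNorm X j

/-- `C_min`, the smallest norm of a column. -/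
def cMin {n p : ℕ} (X : Matrix (Fin n) (Fin p) ℝ) : ℝ :=
  ⨅ j, colNorm X j

/-- `η`, where `η² = B² / (C_min² - B²)`. -/
def eta {n p : ℕ} (B : ℝ) (X : Matrix (Fin n) (Fin p) ℝ) : ℝ :=
  Real.sqrt (B ^ 2 / (cMin X ^ 2 - B ^ 2))

/-- The Schur complement of the upper left block of
`G = [Σ, Σ - diag s; Σ - diag s, Σ]`. -/
def schurG {p : ℕ} (S : Matrix (Fin p) (Fin p) ℝ) (s : Fin p → ℝ) : Matrix (Fin p) (Fin p) ℝ :=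
  S - (S - diagonal s) * S⁻¹ * (S - diagonal s)

/-- `Xt` is a knockoff copy of `X` with parameter `s`:
`Xt = X (I - Σ⁻¹ diag s) + U C`, where `U` has orthonormal columns, which are orthogonal to those
of `X`, and `C` is the (upper triangular) Cholesky factor of the Schur complement of `G`. -/
def IsKnockoffCopy {n p : ℕ} (X Xt : Matrix (Fin n) (Fin p) ℝ) (s : Fin p → ℝ) : Prop :=
  ∃ (U : Matrix (Fin n) (Fin p) ℝ) (C : Matrix (Fin p) (Fin p) ℝ),
    Uᵀ * U = 1 ∧ Uᵀ * X = 0 ∧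
    (∀ i j, j < i → C i j = 0) ∧ (∀ i, 0 ≤ C i i) ∧ Cᵀ * C = schurG (gram X) s ∧
    Xt = X * (1 - (gram X)⁻¹ * diagonal s) + U * C

/-- `K` assigns to every admissible design `X` a knockoff copy of the normalized design `X'`,
made with `diag s = λ_min(Σ') I`. -/
def IsKnockoffMap {n p : ℕ} (B : ℝ)
    (K : Matrix (Fin n) (Fin p) ℝ → Matrix (Fin n) (Fin p) ℝ) : Prop :=
  ∀ X, Admissible B X →
    IsKnockoffCopy (normalize X) (K X) (fun _ => lamMin (gram (normalize X)))

/-- A least-squares estimate: a minimizer of `b ↦ ‖y - Z b‖²`. -/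
def lsEstimate {n : ℕ} {ι : Type*} [Fintype ι] (Z : Matrix (Fin n) ι ℝ)
    (y : EuclideanSpace ℝ (Fin n)) : EuclideanSpace ℝ ι :=
  Classical.epsilon fun b : EuclideanSpace ℝ ι =>
    ∀ c : EuclideanSpace ℝ ι,
      ‖y - WithLp.toLp 2 (Z *ᵥ b.ofLp)‖ ^ 2 ≤ ‖y - WithLp.toLp 2 (Z *ᵥ c.ofLp)‖ ^ 2

/-- The least-squares estimate `β̂'` on the normalized design with its knockoffs, `[X' K(X)]`. -/
def betaHat {n p : ℕ} (K : Matrix (Fin n) (Fin p) ℝ → Matrix (Fin n) (Fin p) ℝ)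
    (A : Dataset n p) : EuclideanSpace ℝ (Fin p ⊕ Fin p) :=
  lsEstimate (fromCols (normalize A.X) (K A.X)) A.y

/-- The constant `ζ`. -/
def zeta (p : ℕ) (σ δ₂ : ℝ) : ℝ :=
  2 * p * σ ^ 2 / (1 - Real.sqrt (2 / p * Real.log (2 / δ₂)))

/-- The `ℓ₂`-sensitivity bound for `β̂'` at the design `X`. -/
def sensitivity {n p : ℕ} (B σ δ₂ : ℝ) (β : EuclideanSpace ℝ (Fin p))
    (X : Matrix (Fin n) (Fin p) ℝ) : ℝ :=
  2 * Real.sqrt (zeta p σ δ₂) /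
      Real.sqrt ((1 - eta B X ^ 2) * lamMin (gram (normalize X)) - eta B X ^ 2)
    + (cMin X - B / eta B X) * ‖β‖

/-- The centered Gaussian law with covariance matrix `v I`. -/
def isoGaussian (ι : Type*) [Fintype ι] [DecidableEq ι] (v : ℝ) :
    Measure (EuclideanSpace ℝ ι) :=
  multivariateGaussian 0 (v • (1 : Matrix ι ι ℝ))

variable {Ω : Type*} [MeasurableSpace Ω]

/-- The (random) data set `A` follows the linear model `y = X β + w`, `w ∼ N(0, σ² I)`, with the
deterministic admissible design `X`. -/
def FollowsModel {n p : ℕ} (P : Measure Ω) (B σ : ℝ) (β : EuclideanSpace ℝ (Fin p))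
    (X : Matrix (Fin n) (Fin p) ℝ) (A : Ω → Dataset n p) : Prop :=
  Admissible B X ∧
  ∃ w : Ω → EuclideanSpace ℝ (Fin n), HasLaw w (isoGaussian (Fin n) (σ ^ 2)) P ∧
    ∀ ω, A ω = ⟨X, WithLp.toLp 2 (X *ᵥ β.ofLp) + w ω⟩

/-- The domain of the mechanism: all random data sets that follow the linear model. -/
def modelData {n p : ℕ} (P : Measure Ω) (B σ : ℝ) (β : EuclideanSpace ℝ (Fin p)) :
    Set (Ω → Dataset n p) :=
  {A | ∃ X, FollowsModel P B σ β X A}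

/-- Random data sets are adjacent if they almost surely differ in at most one observation. -/
def AdjacentAE {n p : ℕ} (P : Measure Ω) (A A' : Ω → Dataset n p) : Prop :=
  ∀ᵐ ω ∂P, Adjacent (A ω) (A' ω)

/-- The release `β̂' + e`: the law of its output, where `e ∼ N(0, v I)` is independent of the
data. -/
def release {n p : ℕ} (P : Measure Ω)
    (K : Matrix (Fin n) (Fin p) ℝ → Matrix (Fin n) (Fin p) ℝ) (v : ℝ) (A : Ω → Dataset n p) :
    Measure (EuclideanSpace ℝ (Fin p ⊕ Fin p)) :=
  (P.prod (isoGaussian (Fin p ⊕ Fin p) v)).map fun z => betaHat K (A z.1) + z.2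

/-- `(ε, δ)`-differential privacy of the mechanism `M` (given by its output laws) with domain `D`
at the input `A`: the defining inequality holds, in both directions, for `A` and every input in
`D` that is adjacent to `A`. -/
def DiffPrivateAt {α R : Type*} [MeasurableSpace R] (ε δ : ℝ) (D : Set α) (adj : α → α → Prop)
    (M : α → Measure R) (A : α) : Prop :=
  ∀ A' ∈ D, adj A A' → ∀ S : Set R, MeasurableSet S →
    M A S ≤ ENNReal.ofReal (Real.exp ε) * M A' S + ENNReal.ofReal δ ∧
    M A' S ≤ ENNReal.ofReal (Real.exp ε) * M A S + ENNReal.ofReal δ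

end KnockoffDP

end

namespace KnockoffDP

open scoped RealInnerProductSpace ENNReal

/-! With `s = λ_min(Σ')`, the Gram matrix of `Z = [X' K(X)]` is bounded below by `λ_min(Σ')`
(`dotProduct_fromCols_mulVec_le`). The mean of `y` is `Z b₀`, where `b₀` carries the rescaled `β`
and zeros on the knockoffs, and `Z (β̂' - b₀)` is the projection of `w` to the column space of `Z`.
So `‖β̂' - b₀‖² ≤ ‖proj w‖² / λ_min(Σ')`. That space has dimension at most `2p`, and a chi-squared
Chernoff bound gives `‖proj w‖² ≤ ζ` outside probability `δ₂ / 2`.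

Replacing one row keeps `λ_min` above `(1 - η²) λ_min(Σ') - η²` (`lamMin_gram_normalize_ge`) and
moves each column norm by at most `C_min - B / η` (`abs_colNorm_sub_le`). The triangle inequality
yields `Δ`: two noise terms and the shift of `b₀`. A union bound over the two noises gives `δ₂`,
whatever their joint law.

For privacy, the Gaussian mechanism (`isoGaussian_preimage_add_le`) is applied for each fixed
outcome of the data where the estimates are `Δ`-close, and integrated; the other outcomes cost at
most `δ₂`. -/

/-! ### Tails of the standard normal law. -/

lemma gaussianReal_Ioi_zero_le : gaussianReal 0 1 (Set.Ioi 0) ≤ 2⁻¹ := by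
  have hsymm : gaussianReal 0 1 (Set.Iio 0) = gaussianReal 0 1 (Set.Ioi 0) := by
    have h := gaussianReal_map_neg (μ := 0) (v := 1)
    rw [neg_zero] at h
    conv_lhs => rw [← h, Measure.map_apply measurable_neg measurableSet_Iio]
    simp
  have hdisj : gaussianReal 0 1 (Set.Iio 0) + gaussianReal 0 1 (Set.Ioi 0) ≤ 1 := by
    rw [← measure_union _ measurableSet_Ioi]
    · exact prob_le_one
    · exact Set.disjoint_left.2 fun x hx hx' => lt_asymm (Set.mem_Iio.1 hx) (Set.mem_Ioi.1 hx')
  rw [hsymm, ← two_mul] at hdisj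
  rwa [ENNReal.le_inv_iff_mul_le, mul_comm]

/-- After a shift by `-t`, the density at `x > 0` is the centered one times `exp (-t²/2 - t x)`, and
`t x ≥ 0`. -/
lemma gaussianReal_Ioi_le_of_nonneg {t : ℝ} (ht : 0 ≤ t) :
    gaussianReal 0 1 (Set.Ioi t) ≤ ENNReal.ofReal (1 / 2 * Real.exp (-t ^ 2 / 2)) := by
  have hshift : gaussianReal 0 1 (Set.Ioi t) = gaussianReal (-t) 1 (Set.Ioi 0) := by
    have h := gaussianReal_map_add_const (μ := 0) (v := 1) (-t)
    rw [zero_add] at h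
    rw [← h, Measure.map_apply (measurable_add_const _) measurableSet_Ioi]
    simp
  have hpdf : ∀ x ∈ Set.Ioi (0 : ℝ), gaussianPDF (-t) 1 x ≤
      ENNReal.ofReal (Real.exp (-t ^ 2 / 2)) * gaussianPDF 0 1 x := by
    intro x hx
    rw [Set.mem_Ioi] at hx
    rw [gaussianPDF, gaussianPDF, ← ENNReal.ofReal_mul (Real.exp_pos _).le]
    refine ENNReal.ofReal_le_ofReal ?_
    rw [gaussianPDFReal, gaussianPDFReal, mul_left_comm, ← Real.exp_add]
    gcongr
    have : 0 ≤ t * x := by positivity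
    simp only [NNReal.coe_one]
    nlinarith
  rw [hshift, gaussianReal_apply _ one_ne_zero]
  calc ∫⁻ x in Set.Ioi 0, gaussianPDF (-t) 1 x
      ≤ ∫⁻ x in Set.Ioi 0, ENNReal.ofReal (Real.exp (-t ^ 2 / 2)) * gaussianPDF 0 1 x :=
        setLIntegral_mono ((measurable_gaussianPDF _ _).const_mul _) hpdf
    _ = ENNReal.ofReal (Real.exp (-t ^ 2 / 2)) * gaussianReal 0 1 (Set.Ioi 0) := by
        rw [lintegral_const_mul _ (measurable_gaussianPDF _ _), gaussianReal_apply _ one_ne_zero]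
    _ ≤ ENNReal.ofReal (Real.exp (-t ^ 2 / 2)) * 2⁻¹ := by gcongr; exact gaussianReal_Ioi_zero_le
    _ = _ := by
        rw [mul_comm, ENNReal.ofReal_mul (by norm_num), one_div,
          ENNReal.ofReal_inv_of_pos (by norm_num)]
        simp

lemma gaussianReal_Ioi_le_of_nonpos {t : ℝ} (ht : t ≤ 0) :
    gaussianReal 0 1 (Set.Ioi t) ≤ ENNReal.ofReal (1 / 2 - t) := by
  have hpdf : ∀ x, gaussianPDF 0 1 x ≤ 1 := by
    intro x
    rw [gaussianPDF, ENNReal.ofReal_le_one, gaussianPDFReal]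
    have h1 : Real.exp (-(x - 0) ^ 2 / (2 * ((1 : NNReal) : ℝ))) ≤ 1 := by
      rw [Real.exp_le_one_iff]
      simp only [NNReal.coe_one]
      nlinarith [sq_nonneg x]
    have h2 : (√(2 * Real.pi * ((1 : NNReal) : ℝ)))⁻¹ ≤ 1 := by
      apply inv_le_one_of_one_le₀
      rw [Real.one_le_sqrt, NNReal.coe_one]
      nlinarith [Real.pi_gt_three]
    exact mul_le_one₀ h2 (Real.exp_pos _).le h1
  have hIoc : gaussianReal 0 1 (Set.Ioc t 0) ≤ ENNReal.ofReal (-t) := by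
    rw [gaussianReal_apply _ one_ne_zero]
    calc ∫⁻ x in Set.Ioc t 0, gaussianPDF 0 1 x ≤ ∫⁻ _ in Set.Ioc t 0, 1 :=
          lintegral_mono fun x => hpdf x
      _ = ENNReal.ofReal (-t) := by simp
  rw [← Set.Ioc_union_Ioi_eq_Ioi ht, sub_eq_add_neg,
    ENNReal.ofReal_add (by norm_num) (by linarith), add_comm]
  refine (measure_union_le _ _).trans (add_le_add hIoc (gaussianReal_Ioi_zero_le.trans ?_))
  rw [one_div, ENNReal.ofReal_inv_of_pos (by norm_num)]
  simp

/-- The tail bound behind the calibration of the Gaussian mechanism. -/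
lemma gaussianReal_Ioi_le_of_log_lt {ε δ c : ℝ} (hε : 0 < ε) (hε1 : ε < 1) (hδ : 0 < δ)
    (hδ1 : δ < 1) (hc : 0 < c) (h : 2 * Real.log (1.25 / δ) < c ^ 2) :
    gaussianReal 0 1 (Set.Ioi (c - ε / (2 * c))) ≤ ENNReal.ofReal δ := by
  have hδexp : 1.25 * Real.exp (-c ^ 2 / 2) < δ := by
    have h1 : 1.25 / δ < Real.exp (c ^ 2 / 2) := by
      rw [← Real.log_lt_iff_lt_exp (by positivity)]
      linarith
    rw [div_lt_iff₀ hδ] at h1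
    rw [neg_div, Real.exp_neg]
    rw [← div_eq_mul_inv, div_lt_iff₀ (Real.exp_pos _)]
    linarith
  rcases le_total 0 (c - ε / (2 * c)) with ht | ht
  -- The squared threshold exceeds `c² - ε`, hence `c² - 1`; the tail is at most `½ e^{1/2}
  -- e^{-c²/2}`, and `e^{1/2} ≤ 2.5` produces the constant `1.25`.
  · refine (gaussianReal_Ioi_le_of_nonneg ht).trans (ENNReal.ofReal_le_ofReal ?_)
    have hsq : c ^ 2 - 1 ≤ (c - ε / (2 * c)) ^ 2 := by
      have h1 : (c - ε / (2 * c)) ^ 2 = c ^ 2 - ε + (ε / (2 * c)) ^ 2 := by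
        field_simp
        ring
      nlinarith [sq_nonneg (ε / (2 * c))]
    have hexp : Real.exp (-(c - ε / (2 * c)) ^ 2 / 2) ≤
        Real.exp (1 / 2) * Real.exp (-c ^ 2 / 2) := by
      rw [← Real.exp_add]
      apply Real.exp_le_exp.2
      linarith
    have he : Real.exp (1 / 2) ≤ 2.5 := by
      have h1 : Real.exp (1 / 2) ≤ Real.exp 1 := Real.exp_le_exp.2 (by norm_num)
      have h2 : Real.exp (1 / 2) * Real.exp (1 / 2) = Real.exp 1 := by
        rw [← Real.exp_add]; norm_num
      nlinarith [Real.exp_one_lt_d9, Real.exp_pos (1 / 2)]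
    nlinarith [Real.exp_pos (-c ^ 2 / 2)]
  -- A nonpositive threshold forces `c² ≤ ε/2 ≤ 1/2`, while the calibration gives `c² > 0.4`. Then
  -- the bound `1/2 - c + ε/(2c)` stays below `0.74`, whereas `δ > 1.25 (1 - c²/2) > 0.9`.
  · refine (gaussianReal_Ioi_le_of_nonpos ht).trans (ENNReal.ofReal_le_ofReal ?_)
    have hlog : (0.2 : ℝ) ≤ Real.log (1.25 / δ) := by
      have h1 : Real.log 1.25 ≤ Real.log (1.25 / δ) := by
        apply Real.log_le_log (by norm_num)
        rw [le_div_iff₀ hδ]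
        linarith
      have h2 := Real.one_sub_inv_le_log_of_pos (x := 1.25) (by norm_num)
      norm_num at h2 h1 ⊢
      linarith
    have hc2 : c ^ 2 ≤ 1 / 2 := by
      have : c ≤ ε / (2 * c) := by linarith
      rw [le_div_iff₀ (by positivity)] at this
      nlinarith
    have hcl : 0.6 ≤ c := by nlinarith
    have h1 : ε / (2 * c) ≤ 1 / 1.2 := by
      apply div_le_div₀ <;> linarith
    have h2 := Real.add_one_le_exp (-c ^ 2 / 2)
    norm_num at h1 hcl ⊢
    nlinarith

/-! ### The Gaussian mechanism. -/

section Shift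

variable {ι : Type*} [Fintype ι]

/-- The Cameron–Martin formula for the standard Gaussian measure. -/
lemma stdGaussian_map_add_const (h : EuclideanSpace ℝ ι) :
    (stdGaussian (EuclideanSpace ℝ ι)).map (· + h) =
      (stdGaussian (EuclideanSpace ℝ ι)).withDensity
        fun x => ENNReal.ofReal (Real.exp (⟪h, x⟫ - ‖h‖ ^ 2 / 2)) := by
  set γ := stdGaussian (EuclideanSpace ℝ ι) with hγ
  have hexp : Integrable (fun x => Real.exp (⟪h, x⟫ - ‖h‖ ^ 2 / 2)) γ := by
    simp_rw [sub_eq_add_neg, Real.exp_add]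
    refine Integrable.mul_const ?_ _
    rw [hγ, ← map_pi_eq_stdGaussian, integrable_map_measure (by fun_prop) (by fun_prop)]
    have : ((fun x => Real.exp ⟪h, x⟫) ∘ WithLp.toLp 2 : (ι → ℝ) → ℝ) =
        fun x => ∏ i, Real.exp (h i * x i) := by
      ext x
      simp [PiLp.inner_apply, Real.exp_sum, mul_comm]
    rw [this]
    exact Integrable.fintype_prod fun i => integrable_exp_mul_gaussianReal (h i)
  have hfin : IsFiniteMeasure (γ.withDensity
      fun x => ENNReal.ofReal (Real.exp (⟪h, x⟫ - ‖h‖ ^ 2 / 2))) :=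
    isFiniteMeasure_withDensity_ofReal hexp.2
  have : IsProbabilityMeasure (γ.map (· + h)) :=
    Measure.isProbabilityMeasure_map (by fun_prop)
  apply Measure.ext_of_charFun
  ext t
  have hL : charFun (γ.map (· + h)) t = Complex.exp (⟪h, t⟫ * Complex.I - ‖t‖ ^ 2 / 2) := by
    rw [charFun_map_add_const, charFun_stdGaussian, ← Complex.exp_add]
    congr 1
    ring
  -- The integrand factors over the coordinates, so the integral is a product of complex moment
  -- generating functions of `N(0, 1)` at `i tⱼ + hⱼ`.
  have hR : charFun (γ.withDensity
      fun x => ENNReal.ofReal (Real.exp (⟪h, x⟫ - ‖h‖ ^ 2 / 2))) t =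
      ∫ x : ι → ℝ, ∏ i, Complex.exp ((t i * Complex.I + h i) * x i) * Complex.exp (-h i ^ 2 / 2)
        ∂Measure.pi fun _ => gaussianReal 0 1 := by
    rw [charFun_apply, integral_withDensity_eq_integral_toReal_smul (by fun_prop) (by simp),
      hγ, ← map_pi_eq_stdGaussian, integral_map (by fun_prop)
        (Measurable.aestronglyMeasurable (by fun_prop))]
    congr with x
    rw [ENNReal.toReal_ofReal (Real.exp_pos _).le, Complex.real_smul, Complex.ofReal_exp,
      ← Complex.exp_add, EuclideanSpace.real_norm_sq_eq]
    simp_rw [← Complex.exp_add]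
    rw [← Complex.exp_sum]
    congr 1
    simp only [PiLp.inner_apply, RCLike.inner_apply, conj_trivial]
    push_cast
    rw [Finset.sum_div, ← Finset.sum_sub_distrib, Finset.sum_mul, ← Finset.sum_add_distrib]
    refine Finset.sum_congr rfl fun i _ => ?_
    ring
  have hmgf : ∀ z : ℂ, ∫ x : ℝ, Complex.exp (z * x) ∂gaussianReal 0 1 = Complex.exp (z ^ 2 / 2) := by
    intro z
    have := complexMGF_id_gaussianReal (μ := 0) (v := 1) z
    simpa [complexMGF] using this
  rw [hL, hR, integral_fintype_prod_eq_prod (𝕜 := ℂ)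
    (f := fun i (x : ℝ) => Complex.exp ((t i * Complex.I + h i) * x) * Complex.exp (-h i ^ 2 / 2))]
  simp_rw [integral_mul_const, hmgf, ← Complex.exp_add]
  rw [← Complex.exp_sum]
  congr 1
  rw [← Complex.ofReal_pow, EuclideanSpace.real_norm_sq_eq]
  simp only [PiLp.inner_apply, RCLike.inner_apply, conj_trivial]
  push_cast
  rw [Finset.sum_div, Finset.sum_mul, ← Finset.sum_sub_distrib]
  refine Finset.sum_congr rfl fun i _ => ?_
  linear_combination (-(t i : ℂ) ^ 2 / 2) * Complex.I_sq

lemma stdGaussian_map_inner (u : EuclideanSpace ℝ ι) (hu : ‖u‖ = 1) :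
    (stdGaussian (EuclideanSpace ℝ ι)).map (fun x => ⟪u, x⟫) = gaussianReal 0 1 := by
  have : IsProbabilityMeasure ((stdGaussian (EuclideanSpace ℝ ι)).map (fun x => ⟪u, x⟫)) :=
    Measure.isProbabilityMeasure_map (by fun_prop)
  apply Measure.ext_of_charFun
  ext t
  have h := charFun_stdGaussian (t • u)
  rw [charFun_apply] at h
  rw [charFun_apply, integral_map (by fun_prop) (by fun_prop), charFun_gaussianReal]
  simp only [norm_smul, hu, inner_smul_right] at h
  simp only [RCLike.inner_apply, conj_trivial, real_inner_comm _ u] at h ⊢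
  rw [h]
  congr 1
  simp [← Complex.ofReal_pow]
  ring

/-- The Gaussian mechanism with unit noise, for two inputs that differ by `h`. -/
lemma stdGaussian_preimage_add_le {ε δ : ℝ} (hε : 0 < ε) (hε1 : ε < 1) (hδ : 0 < δ) (hδ1 : δ < 1)
    (h : EuclideanSpace ℝ ι) (hh : 2 * Real.log (1.25 / δ) * ‖h‖ ^ 2 < ε ^ 2)
    {S : Set (EuclideanSpace ℝ ι)} (hS : MeasurableSet S) :
    stdGaussian (EuclideanSpace ℝ ι) {x | x + h ∈ S} ≤
      ENNReal.ofReal (Real.exp ε) * stdGaussian (EuclideanSpace ℝ ι) S + ENNReal.ofReal δ := by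
  set γ := stdGaussian (EuclideanSpace ℝ ι) with hγ
  rcases eq_or_ne h 0 with rfl | h0
  · simp only [add_zero, Set.ofPred_mem_eq]
    refine le_add_right (le_mul_of_one_le_left' ?_)
    rw [ENNReal.one_le_ofReal]
    exact Real.one_le_exp hε.le
  have hr : 0 < ‖h‖ := norm_pos_iff.2 h0
  -- `L` is where the log-likelihood ratio exceeds `ε`. Off `L` the density is at most `e^ε`; under
  -- the shifted law, `L` is a half-space whose mass is the normal tail with `c = ε / ‖h‖`.
  let L : Set (EuclideanSpace ℝ ι) := {x | ε < ⟪h, x⟫ - ‖h‖ ^ 2 / 2}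
  have hLm : MeasurableSet L := measurableSet_lt measurable_const (by fun_prop)
  have hmap : ∀ T, MeasurableSet T → γ {x | x + h ∈ T} = γ.map (· + h) T := fun T hT =>
    (Measure.map_apply (by fun_prop) hT).symm
  have hL : γ {x | x + h ∈ L} ≤ ENNReal.ofReal δ := by
    have hu : ‖‖h‖⁻¹ • h‖ = 1 := by simp [norm_smul, hr.ne']
    have hset : {x | x + h ∈ L} =
        (fun x => ⟪‖h‖⁻¹ • h, x⟫) ⁻¹' Set.Ioi (ε / ‖h‖ - ε / (2 * (ε / ‖h‖))) := by
      ext x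
      simp only [L, Set.mem_ofPred_eq, inner_add_right, real_inner_self_eq_norm_sq, Set.mem_preimage,
        Set.mem_Ioi, real_inner_smul_left]
      have e1 : ε / ‖h‖ - ε / (2 * (ε / ‖h‖)) = ‖h‖⁻¹ * (ε - ‖h‖ ^ 2 / 2) := by
        field_simp
      rw [e1, mul_lt_mul_iff_right₀ (by positivity)]
      constructor <;> intro <;> linarith
    rw [hset, ← Measure.map_apply (by fun_prop) measurableSet_Ioi, hγ, stdGaussian_map_inner _ hu]
    refine gaussianReal_Ioi_le_of_log_lt hε hε1 hδ hδ1 (by positivity) ?_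
    rw [div_pow, lt_div_iff₀ (by positivity)]
    exact hh
  have hLc : γ.map (· + h) (S \ L) ≤ ENNReal.ofReal (Real.exp ε) * γ S := by
    rw [hγ, stdGaussian_map_add_const, withDensity_apply _ (hS.diff hLm)]
    calc _ ≤ ∫⁻ _ in S \ L, ENNReal.ofReal (Real.exp ε) ∂γ := by
          refine setLIntegral_mono measurable_const fun x hx => ?_
          exact ENNReal.ofReal_le_ofReal (Real.exp_le_exp.2 (not_lt.1 hx.2))
      _ = ENNReal.ofReal (Real.exp ε) * γ (S \ L) := by simp
      _ ≤ _ := by gcongr; exact Set.sdiff_subset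
  calc γ {x | x + h ∈ S} = γ.map (· + h) S := hmap S hS
    _ ≤ γ.map (· + h) (S \ L ∪ L) := measure_mono fun x hx => by
        by_cases hxL : x ∈ L
        · exact Or.inr hxL
        · exact Or.inl ⟨hx, hxL⟩
    _ ≤ γ.map (· + h) (S \ L) + γ.map (· + h) L := measure_union_le _ _
    _ ≤ _ := add_le_add hLc (by rw [← hmap L hLm]; exact hL)

variable [DecidableEq ι]

open scoped MatrixOrder in
lemma isoGaussian_sq (c : ℝ) :
    isoGaussian ι (c ^ 2) = (stdGaussian (EuclideanSpace ℝ ι)).map (|c| • ·) := by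
  have hc : CFC.sqrt (c ^ 2 • (1 : Matrix ι ι ℝ)) = |c| • (1 : Matrix ι ι ℝ) := by
    refine CFC.sqrt_unique ?_ ?_
    · rw [smul_mul_smul_comm, one_mul, abs_mul_abs_self, sq]
    · exact (Matrix.PosSemidef.one.smul (abs_nonneg c)).nonneg
  rw [isoGaussian, multivariateGaussian, hc]
  congr with x
  simp

instance (v : ℝ) : IsProbabilityMeasure (isoGaussian ι v) := by
  unfold isoGaussian
  infer_instance

/-- The Gaussian mechanism, for two inputs `a` and `b` at distance at most `Δ`. -/
lemma isoGaussian_preimage_add_le {ε δ Δ κ : ℝ} (hε : 0 < ε) (hε1 : ε < 1) (hδ : 0 < δ)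
    (hδ1 : δ < 1) (hκ : 2 * Real.log (1.25 / δ) / ε ^ 2 * Δ ^ 2 < κ ^ 2)
    {a b : EuclideanSpace ℝ ι} (hab : ‖a - b‖ ≤ Δ)
    {S : Set (EuclideanSpace ℝ ι)} (hS : MeasurableSet S) :
    isoGaussian ι (κ ^ 2) {x | a + x ∈ S} ≤
      ENNReal.ofReal (Real.exp ε) * isoGaussian ι (κ ^ 2) {x | b + x ∈ S} + ENNReal.ofReal δ := by
  have hlog : 0 < Real.log (1.25 / δ) := Real.log_pos (by rw [lt_div_iff₀ hδ]; linarith)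
  have hκ0 : κ ≠ 0 := by
    rintro rfl
    have : 0 ≤ 2 * Real.log (1.25 / δ) / ε ^ 2 * Δ ^ 2 := by positivity
    norm_num at hκ
    linarith
  have hpos : 0 < |κ| := abs_pos.2 hκ0
  have hm : ∀ c : EuclideanSpace ℝ ι, isoGaussian ι (κ ^ 2) {x | c + x ∈ S} =
      stdGaussian (EuclideanSpace ℝ ι) {x | c + |κ| • x ∈ S} := fun c => by
    rw [isoGaussian_sq, Measure.map_apply (by fun_prop)]
    · rfl
    · exact (measurable_const_add c) hS
  have hT : MeasurableSet {x : EuclideanSpace ℝ ι | b + |κ| • x ∈ S} :=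
    (show Measurable fun x : EuclideanSpace ℝ ι => b + |κ| • x by fun_prop) hS
  rw [hm, hm]
  -- In units of the noise: `a + |κ| x = b + |κ| (x + |κ|⁻¹ (a - b))`.
  convert stdGaussian_preimage_add_le hε hε1 hδ hδ1 (|κ|⁻¹ • (a - b)) ?_ hT using 4 with x
  · simp only [Set.mem_ofPred_eq, smul_add, smul_smul, mul_inv_cancel₀ hpos.ne', one_smul]
    congr! 1
    abel
  · rw [norm_smul, mul_pow, norm_inv, Real.norm_eq_abs, abs_abs, inv_pow, sq_abs]
    have h1 : ‖a - b‖ ^ 2 ≤ Δ ^ 2 := by gcongr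
    have h2 : 0 < κ ^ 2 := by positivity
    rw [div_mul_eq_mul_div, div_lt_iff₀ (by positivity)] at hκ
    rw [mul_left_comm, inv_mul_lt_iff₀ h2]
    nlinarith

end Shift

/-! ### Chi-squared tails and projections of Gaussian noise. -/

section ChiSquare

variable {E : Type*} [NormedAddCommGroup E] [InnerProductSpace ℝ E] [FiniteDimensional ℝ E]
  [MeasurableSpace E] [BorelSpace E]

lemma integral_exp_mul_sq_gaussianReal {s : ℝ} (hs : s < 1 / 2) :
    Integrable (fun x => Real.exp (s * x ^ 2)) (gaussianReal 0 1) ∧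
    ∫ x, Real.exp (s * x ^ 2) ∂gaussianReal 0 1 = (√(1 - 2 * s))⁻¹ := by
  have hb : 0 < 1 / 2 - s := by linarith
  have hfun : ∀ x : ℝ, gaussianPDFReal 0 1 x * Real.exp (s * x ^ 2) =
      (√(2 * Real.pi))⁻¹ * Real.exp (-(1 / 2 - s) * x ^ 2) := fun x => by
    rw [gaussianPDFReal, mul_assoc, ← Real.exp_add]
    simp only [NNReal.coe_one, mul_one]
    congr 2
    ring
  constructor
  · rw [gaussianReal_of_var_ne_zero _ one_ne_zero,
      integrable_withDensity_iff_integrable_smul' (measurable_gaussianPDF _ _)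
        (Filter.Eventually.of_forall fun _ => gaussianPDF_lt_top)]
    simp only [toReal_gaussianPDF, smul_eq_mul, hfun]
    exact (integrable_exp_neg_mul_sq hb).const_mul _
  · rw [integral_gaussianReal_eq_integral_smul one_ne_zero]
    simp only [smul_eq_mul, hfun]
    rw [integral_const_mul, integral_gaussian, ← Real.sqrt_inv,
      ← Real.sqrt_mul (by positivity), ← Real.sqrt_inv]
    congr 1
    have := Real.pi_pos
    have h2 : 1 - 2 * s ≠ 0 := by linarith
    field_simp

lemma mgf_norm_sq_stdGaussian {s : ℝ} (hs : s < 1 / 2) :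
    Integrable (fun x => Real.exp (s * ‖x‖ ^ 2)) (stdGaussian E) ∧
    mgf (fun x => ‖x‖ ^ 2) (stdGaussian E) s = (√(1 - 2 * s))⁻¹ ^ Module.finrank ℝ E := by
  have hcomp : ∀ x : Fin (Module.finrank ℝ E) → ℝ,
      Real.exp (s * ‖∑ i, x i • stdOrthonormalBasis ℝ E i‖ ^ 2) =
        ∏ i, Real.exp (s * x i ^ 2) := fun x => by
    rw [← real_inner_self_eq_norm_sq, (stdOrthonormalBasis ℝ E).orthonormal.inner_sum,
      ← Real.exp_sum, Finset.mul_sum]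
    simp [sq]
  have hm : Measurable fun x : Fin (Module.finrank ℝ E) → ℝ =>
      ∑ i, x i • stdOrthonormalBasis ℝ E i := by fun_prop
  have hc : Measurable fun x : E => Real.exp (s * ‖x‖ ^ 2) := by fun_prop
  constructor
  · rw [stdGaussian, integrable_map_measure hc.aestronglyMeasurable hm.aemeasurable]
    refine (Integrable.fintype_prod fun _ => (integral_exp_mul_sq_gaussianReal hs).1).congr ?_
    exact Filter.Eventually.of_forall fun x => (hcomp x).symm
  · rw [mgf, stdGaussian, integral_map hm.aemeasurable hc.aestronglyMeasurable]
    simp_rw [hcomp]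
    rw [integral_fintype_prod_eq_prod (𝕜 := ℝ) (f := fun _ (x : ℝ) => Real.exp (s * x ^ 2))]
    simp [(integral_exp_mul_sq_gaussianReal hs).2]

/-- Apply `x ≤ sinh x` to `x = -log (1 - t)`; the resulting bound is smaller than the stated one by
`t³ / (2 (1 - t))`. -/
lemma neg_log_one_sub_le {t : ℝ} (ht : 0 ≤ t) (ht1 : t < 1) :
    -Real.log (1 - t) ≤ t / (1 - t) - t ^ 2 / 2 := by
  have hpos : 0 < 1 - t := by linarith
  have h0 : 0 ≤ Real.log (1 - t)⁻¹ :=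
    Real.log_nonneg ((one_le_inv₀ hpos).2 (by linarith))
  have h := Real.self_le_sinh_iff.2 h0
  rw [Real.sinh_log (by positivity), Real.log_inv, inv_inv] at h
  refine h.trans ?_
  rw [← sub_nonneg]
  have : t / (1 - t) - t ^ 2 / 2 - ((1 - t)⁻¹ - (1 - t)) / 2 = t ^ 3 / (2 * (1 - t)) := by
    field_simp
    ring
  rw [this]
  positivity

/-- A Chernoff bound for the chi-squared distribution. -/
lemma stdGaussian_norm_sq_tail {t : ℝ} (ht : 0 ≤ t) (ht1 : t < 1) {k : ℕ}
    (hk : Module.finrank ℝ E ≤ k) :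
    (stdGaussian E).real {x | k / (1 - t) ≤ ‖x‖ ^ 2} ≤ Real.exp (-(k * t ^ 2 / 4)) := by
  have hpos : 0 < 1 - t := by linarith
  -- `s = t / 2` is the optimal Chernoff exponent for the threshold `k / (1 - t)` in dimension `k`;
  -- a smaller dimension only lowers the moment generating function.
  obtain ⟨hint, hmgf⟩ := mgf_norm_sq_stdGaussian (E := E) (s := t / 2) (by linarith)
  refine (measure_ge_le_exp_mul_mgf (X := fun x : E => ‖x‖ ^ 2) (k / (1 - t)) (by positivity)
    hint).trans ?_
  rw [hmgf, mul_div_cancel₀ _ (two_ne_zero' ℝ)]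
  have hbase : (√(1 - t))⁻¹ = Real.exp (-Real.log (1 - t) / 2) := by
    rw [Real.exp_half, Real.exp_neg, Real.exp_log hpos, Real.sqrt_inv]
  have hone : 1 ≤ (√(1 - t))⁻¹ := by
    rw [one_le_inv₀ (Real.sqrt_pos.2 hpos), Real.sqrt_le_one]
    linarith
  calc _ ≤ Real.exp (-(t / 2) * (k / (1 - t))) * (√(1 - t))⁻¹ ^ k := by gcongr
    _ = Real.exp (k / 2 * (-Real.log (1 - t) - t / (1 - t))) := by
      rw [hbase, ← Real.exp_nat_mul, ← Real.exp_add]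
      congr 1
      ring
    _ ≤ _ := by
      apply Real.exp_le_exp.2
      have h := neg_log_one_sub_le ht ht1
      have hk0 : (0 : ℝ) ≤ k := k.cast_nonneg
      have := mul_le_mul_of_nonneg_left h hk0
      linarith

lemma stdGaussian_map_orthogonalProjectionOnto (V : Submodule ℝ E) :
    (stdGaussian E).map V.orthogonalProjectionOnto = stdGaussian V := by
  have : IsProbabilityMeasure ((stdGaussian E).map V.orthogonalProjectionOnto) :=
    Measure.isProbabilityMeasure_map (by fun_prop)
  apply Measure.ext_of_charFun
  ext t
  rw [charFun_apply, integral_map (by fun_prop) (by fun_prop), charFun_stdGaussian]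
  have h := charFun_stdGaussian (t : E)
  rw [charFun_apply] at h
  rw [show ‖t‖ = ‖(t : E)‖ from rfl, ← h]
  congr with x
  rw [real_inner_comm, Submodule.inner_orthogonalProjectionOnto_eq_of_mem_left, real_inner_comm]

end ChiSquare

lemma isoGaussian_orthogonalProjection_tail {ι : Type*} [Fintype ι] [DecidableEq ι] {p : ℕ}
    (hp : 0 < p) {σ δ₂ : ℝ} (hδ₂ : 2 * Real.exp (-(p : ℝ) / 2) < δ₂)
    (V : Submodule ℝ (EuclideanSpace ℝ ι)) (hV : Module.finrank ℝ V ≤ 2 * p) :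
    isoGaussian ι (σ ^ 2) {w | zeta p σ δ₂ < ‖V.orthogonalProjectionOnto w‖ ^ 2} ≤
      ENNReal.ofReal (δ₂ / 2) := by
  have hδpos : 0 < δ₂ := lt_trans (by positivity) hδ₂
  -- For `δ₂ ≥ 2` the bound is trivial. Otherwise `δ₂ > 2 e^{-p/2}` says exactly that `t < 1`, and
  -- `t` is chosen so that the Chernoff exponent `2p t² / 4` equals `log (2 / δ₂)`.
  rcases le_or_gt 2 δ₂ with h2 | h2
  · exact prob_le_one.trans (by rw [ENNReal.one_le_ofReal]; linarith)
  have hp' : (0 : ℝ) < p := by exact_mod_cast hp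
  have hlog : 0 < Real.log (2 / δ₂) := Real.log_pos (by rwa [one_lt_div hδpos])
  set t := √(2 / p * Real.log (2 / δ₂)) with ht
  have ht0 : 0 ≤ t := Real.sqrt_nonneg _
  have htsq : t ^ 2 = 2 / p * Real.log (2 / δ₂) := Real.sq_sqrt (by positivity)
  have hlog2 : Real.log (2 / δ₂) < p / 2 := by
    rw [Real.log_lt_iff_lt_exp (by positivity), div_lt_iff₀ hδpos]
    rw [neg_div, Real.exp_neg, ← div_eq_mul_inv, div_lt_iff₀ (Real.exp_pos _)] at hδ₂
    linarith
  have ht1 : t < 1 := by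
    rw [← sq_lt_one_iff₀ ht0, htsq, div_mul_eq_mul_div, div_lt_one hp']
    linarith
  have hz : zeta p σ δ₂ = σ ^ 2 * ((2 * p : ℕ) / (1 - t)) := by
    rw [zeta, ← ht]
    push_cast
    ring
  rw [isoGaussian_sq, Measure.map_apply (by fun_prop)
    (measurableSet_lt measurable_const (by fun_prop))]
  calc _ ≤ stdGaussian (EuclideanSpace ℝ ι)
        (V.orthogonalProjectionOnto ⁻¹' {x | (2 * p : ℕ) / (1 - t) ≤ ‖x‖ ^ 2}) := by
        -- Strictness of the inequality covers `σ = 0`, where the event is empty.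
        refine measure_mono fun x hx => ?_
        simp only [Set.mem_preimage, Set.mem_ofPred_eq, map_smul, norm_smul, mul_pow, hz,
          Real.norm_eq_abs, abs_abs, sq_abs] at hx ⊢
        exact (lt_of_mul_lt_mul_left hx (sq_nonneg σ)).le
    _ = stdGaussian V {x | (2 * p : ℕ) / (1 - t) ≤ ‖x‖ ^ 2} := by
        rw [← stdGaussian_map_orthogonalProjectionOnto V, Measure.map_apply (by fun_prop)
          (measurableSet_le measurable_const (by fun_prop))]
    _ ≤ ENNReal.ofReal (δ₂ / 2) := by
        rw [← ofReal_measureReal]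
        refine ENNReal.ofReal_le_ofReal ((stdGaussian_norm_sq_tail ht0 ht1 hV).trans_eq ?_)
        have : -(((2 * p : ℕ) : ℝ) * t ^ 2 / 4) = -Real.log (2 / δ₂) := by
          rw [htsq]
          push_cast
          field_simp
          ring
        rw [this, Real.exp_neg, Real.exp_log (by positivity), inv_div]

lemma norm_toLp_sq {ι : Type*} [Fintype ι] (v : ι → ℝ) :
    ‖(WithLp.toLp 2 v : EuclideanSpace ℝ ι)‖ ^ 2 = v ⬝ᵥ v := by
  rw [EuclideanSpace.real_norm_sq_eq]
  simp [dotProduct, sq]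

/-! ### Variational description of the smallest eigenvalue. -/

section Eigenvalues

variable {p : ℕ} {A : Matrix (Fin p) (Fin p) ℝ}

open scoped Pointwise in
lemma lamMin_mul_dotProduct_le (hA : A.IsHermitian) (v : Fin p → ℝ) :
    lamMin A * (v ⬝ᵥ v) ≤ v ⬝ᵥ A *ᵥ v := by
  have hfin : (spectrum ℝ A).Finite := by
    rw [hA.spectrum_real_eq_range_eigenvalues]
    exact Set.finite_range _
  have hB : (A - lamMin A • (1 : Matrix (Fin p) (Fin p) ℝ)).IsHermitian :=
    hA.sub (Matrix.isHermitian_one.smul (by simp [IsSelfAdjoint]))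
  have hpos : (A - lamMin A • (1 : Matrix (Fin p) (Fin p) ℝ)).PosSemidef := by
    refine hB.posSemidef_iff_eigenvalues_nonneg.2 fun i => ?_
    have hi : hB.eigenvalues i ∈ spectrum ℝ A - ({lamMin A} : Set ℝ) := by
      rw [spectrum.sub_singleton_eq, Algebra.algebraMap_eq_smul_one]
      exact hB.eigenvalues_mem_spectrum_real i
    obtain ⟨μ, hμ, ν, hν, h⟩ := hi
    rw [Set.mem_singleton_iff] at hν
    have h' : μ - ν = hB.eigenvalues i := h
    have : lamMin A ≤ μ := csInf_le hfin.bddBelow hμ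
    show 0 ≤ hB.eigenvalues i
    linarith
  have h := hpos.dotProduct_mulVec_nonneg v
  simp only [star_trivial, sub_mulVec, dotProduct_sub, smul_mulVec, one_mulVec,
    dotProduct_smul, smul_eq_mul] at h
  linarith

/-- Test the form on unit eigenvectors; `0 < p` makes the spectrum nonempty, so that its `sInf` is
not the default value `0`. -/
lemma le_lamMin (hp : 0 < p) (hA : A.IsHermitian) {m : ℝ}
    (h : ∀ v : Fin p → ℝ, m * (v ⬝ᵥ v) ≤ v ⬝ᵥ A *ᵥ v) : m ≤ lamMin A := by
  have : Nonempty (Fin p) := ⟨⟨0, hp⟩⟩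
  rw [lamMin, hA.spectrum_real_eq_range_eigenvalues]
  refine le_csInf (Set.range_nonempty _) ?_
  rintro _ ⟨i, rfl⟩
  have hv := h (hA.eigenvectorBasis i)
  have hn : (hA.eigenvectorBasis i).ofLp ⬝ᵥ (hA.eigenvectorBasis i).ofLp = 1 := by
    rw [← norm_toLp_sq]
    simp
  rwa [hA.mulVec_eigenvectorBasis, dotProduct_smul, hn, smul_eq_mul, mul_one, mul_one] at hv

end Eigenvalues

/-! ### Column scaling and admissible designs. -/

section Gram

variable {n p : ℕ} (X : Matrix (Fin n) (Fin p) ℝ)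

lemma gram_isHermitian : (gram X).IsHermitian := by
  simp [gram, Matrix.IsHermitian, conjTranspose_eq_transpose_of_trivial]

lemma dotProduct_gram_mulVec (v : Fin p → ℝ) : v ⬝ᵥ gram X *ᵥ v = (X *ᵥ v) ⬝ᵥ (X *ᵥ v) := by
  rw [gram, ← mulVec_mulVec, dotProduct_mulVec, vecMul_transpose]

lemma normalize_eq : normalize X = X * diagonal fun j => (colNorm X j)⁻¹ := by
  ext i j
  simp [normalize, div_eq_mul_inv]

lemma gram_normalize : gram (normalize X) =
    diagonal (fun j => (colNorm X j)⁻¹) * gram X * diagonal fun j => (colNorm X j)⁻¹ := by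
  rw [normalize_eq, gram, gram, transpose_mul, diagonal_transpose]
  simp only [Matrix.mul_assoc]

lemma colNorm_sq (j : Fin p) : colNorm X j ^ 2 = ∑ i, X i j ^ 2 := by
  simp [colNorm, EuclideanSpace.real_norm_sq_eq]

lemma rowNorm_sq (i : Fin n) : rowNorm X i ^ 2 = ∑ j, X i j ^ 2 := by
  simp [rowNorm, EuclideanSpace.real_norm_sq_eq]

lemma colNorm_nonneg (j : Fin p) : 0 ≤ colNorm X j := norm_nonneg _

lemma rowNorm_nonneg (i : Fin n) : 0 ≤ rowNorm X i := norm_nonneg _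

lemma sq_le_rowNorm_sq (i : Fin n) (j : Fin p) : X i j ^ 2 ≤ rowNorm X i ^ 2 := by
  rw [rowNorm_sq]
  exact Finset.single_le_sum (f := fun j => X i j ^ 2) (fun _ _ => sq_nonneg _) (Finset.mem_univ j)

lemma cMin_le (j : Fin p) : cMin X ≤ colNorm X j :=
  ciInf_le (Set.finite_range _).bddBelow j

variable {X} {B : ℝ}

lemma Admissible.pos (hp : 0 < p) (h : Admissible B X) : 0 < B := by
  by_contra! hB
  have hX : X = 0 := by
    ext i j
    have h1 := sq_le_rowNorm_sq X i j
    have h2 : rowNorm X i = 0 := le_antisymm ((h.row_le i).trans hB) (rowNorm_nonneg X i)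
    rw [h2] at h1
    simpa using pow_eq_zero_iff two_ne_zero |>.1 (le_antisymm (by simpa using h1) (sq_nonneg _))
  have : Nonempty (Fin p) := ⟨⟨0, hp⟩⟩
  have h0 := h.isUnit_det
  simp [gram, hX, det_zero] at h0

lemma Admissible.colNorm_pos (hp : 0 < p) (h : Admissible B X) (j : Fin p) : 0 < colNorm X j :=
  (h.pos hp).trans_le (h.le_col j)

lemma Admissible.isUnit_det_gram_normalize (hp : 0 < p) (h : Admissible B X) :
    IsUnit (gram (normalize X)).det := by
  rw [gram_normalize, det_mul, det_mul, det_diagonal]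
  have : IsUnit (∏ j, (colNorm X j)⁻¹) :=
    (Finset.prod_pos fun j _ => inv_pos.2 (h.colNorm_pos hp j)).ne'.isUnit
  exact (this.mul h.isUnit_det).mul this

/-- This change of variables moves quadratic forms of normalized Gram matrices to the raw designs,
where adjacent data differ in one row only. -/
lemma Admissible.normalize_mulVec_mul (hp : 0 < p) (h : Admissible B X) (b : Fin p → ℝ) :
    normalize X *ᵥ (fun j => colNorm X j * b j) = X *ᵥ b := by
  ext i
  rw [mulVec, mulVec, dotProduct, dotProduct]
  refine Finset.sum_congr rfl fun j _ => ?_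
  have := (h.colNorm_pos hp j).ne'
  simp only [normalize, of_apply]
  field_simp

end Gram

/-! ### The Gram matrix of a design with its knockoffs. -/

section Knockoff

variable {n p : ℕ} {X Xt : Matrix (Fin n) (Fin p) ℝ} {l : ℝ}

/-- The Gram matrix of a design with its knockoffs. -/
lemma IsKnockoffCopy.gram_eq (hX : IsUnit (gram X).det) (h : IsKnockoffCopy X Xt fun _ => l) :
    Xᵀ * Xt = gram X - l • (1 : Matrix (Fin p) (Fin p) ℝ) ∧ Xtᵀ * Xt = gram X := by
  obtain ⟨U, C, hU, hUX, -, -, hC, rfl⟩ := h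
  set S := gram X with hS
  have hd : diagonal (fun _ : Fin p => l) = l • (1 : Matrix (Fin p) (Fin p) ℝ) := by
    rw [smul_one_eq_diagonal]
  rw [schurG, hd] at hC
  rw [hd]
  have hXU : Xᵀ * U = 0 := by
    rw [← transpose_transpose (Xᵀ * U), transpose_mul, transpose_transpose, hUX, transpose_zero]
  have hST : Sᵀ = S := by simp [hS, gram]
  have hinvT : S⁻¹ᵀ = S⁻¹ := by rw [transpose_nonsing_inv, hST]
  have hinv : S * S⁻¹ = 1 := mul_nonsing_inv _ hX
  have h1 : Xᵀ * (X * (1 - S⁻¹ * l • (1 : Matrix (Fin p) (Fin p) ℝ)) + U * C) =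
      S - l • (1 : Matrix (Fin p) (Fin p) ℝ) := by
    rw [Matrix.mul_add, ← Matrix.mul_assoc, ← Matrix.mul_assoc, hXU, Matrix.zero_mul, add_zero,
      show Xᵀ * X = S from rfl, Matrix.mul_sub, ← Matrix.mul_assoc, hinv, Matrix.mul_one,
      Matrix.one_mul]
  refine ⟨h1, ?_⟩
  have h2 : Uᵀ * (X * (1 - S⁻¹ * l • (1 : Matrix (Fin p) (Fin p) ℝ)) + U * C) = C := by
    rw [Matrix.mul_add, ← Matrix.mul_assoc, ← Matrix.mul_assoc, hUX, hU, Matrix.zero_mul,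
      zero_add, Matrix.one_mul]
  -- The product is `(1 - l S⁻¹)(S - l) + CᵀC`; the first term equals `(S - l) S⁻¹ (S - l)`, which
  -- the Schur complement cancels.
  rw [transpose_add, transpose_mul, transpose_mul, Matrix.add_mul, Matrix.mul_assoc,
    Matrix.mul_assoc, h1, h2, hC, transpose_sub, transpose_mul, transpose_one, hinvT,
    transpose_smul, transpose_one, Matrix.sub_mul S _ S⁻¹, hinv]
  abel

/-- For `b = (u, v)` the right side is `(u + v)ᵀ Σ (u + v) - 2 l u·v ≥ l ‖u + v‖² - 2 l u·v = l
‖b‖²`. -/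
lemma dotProduct_fromCols_mulVec_le (hX : IsUnit (gram X).det)
    (hl : ∀ v : Fin p → ℝ, l * (v ⬝ᵥ v) ≤ v ⬝ᵥ gram X *ᵥ v) (h : IsKnockoffCopy X Xt fun _ => l)
    (b : Fin p ⊕ Fin p → ℝ) :
    l * (b ⬝ᵥ b) ≤ (fromCols X Xt *ᵥ b) ⬝ᵥ (fromCols X Xt *ᵥ b) := by
  obtain ⟨h1, h2⟩ := h.gram_eq hX
  obtain ⟨u, v, rfl⟩ : ∃ u v : Fin p → ℝ, b = Sum.elim u v :=
    ⟨b ∘ Sum.inl, b ∘ Sum.inr, (Sum.elim_comp_inl_inr b).symm⟩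
  have huu : (X *ᵥ u) ⬝ᵥ (X *ᵥ u) = u ⬝ᵥ gram X *ᵥ u := (dotProduct_gram_mulVec X u).symm
  have huv : (X *ᵥ u) ⬝ᵥ (Xt *ᵥ v) = u ⬝ᵥ gram X *ᵥ v - l * (u ⬝ᵥ v) := by
    rw [← vecMul_transpose, ← dotProduct_mulVec, mulVec_mulVec, h1, sub_mulVec, smul_mulVec,
      one_mulVec, dotProduct_sub, dotProduct_smul, smul_eq_mul]
  have hvv : (Xt *ᵥ v) ⬝ᵥ (Xt *ᵥ v) = v ⬝ᵥ gram X *ᵥ v := by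
    rw [← h2]
    exact (dotProduct_gram_mulVec Xt v).symm
  have hsymm : v ⬝ᵥ gram X *ᵥ u = u ⬝ᵥ gram X *ᵥ v := by
    rw [dotProduct_mulVec, ← mulVec_transpose, dotProduct_comm,
      show (gram X)ᵀ = gram X by simp [gram]]
  have hl' := hl (u + v)
  simp only [fromCols_mulVec_sumElim, sumElim_dotProduct_sumElim, dotProduct_add, add_dotProduct,
    mulVec_add, dotProduct_comm (Xt *ᵥ v) (X *ᵥ u), dotProduct_comm v u] at hl' ⊢
  rw [huu, huv, hvv]
  rw [hsymm] at hl'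
  linarith

end Knockoff

/-! ### Least squares as projection. -/

section LeastSquares

variable {n : ℕ} {ι : Type*} [Fintype ι] {Z : Matrix (Fin n) ι ℝ}

/-- A least-squares estimate is mapped to the projection of the responses to the column space. -/
lemma toEuclideanLin_lsEstimate [DecidableEq ι] (Z : Matrix (Fin n) ι ℝ)
    (y : EuclideanSpace ℝ (Fin n)) :
    Z.toEuclideanLin (lsEstimate Z y) =
      (LinearMap.range Z.toEuclideanLin).starProjection y := by
  set V := LinearMap.range Z.toEuclideanLin with hV
  have hpyth : ∀ c, ‖y - Z.toEuclideanLin c‖ ^ 2 =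
      ‖y - V.starProjection y‖ ^ 2 + ‖V.starProjection y - Z.toEuclideanLin c‖ ^ 2 := fun c => by
    have h0 : ⟪y - V.starProjection y, V.starProjection y - Z.toEuclideanLin c⟫ = 0 :=
      Submodule.inner_left_of_mem_orthogonal
        (V.sub_mem (V.starProjection_apply_mem y) (LinearMap.mem_range_self _ c))
        (V.sub_starProjection_mem_orthogonal y)
    have := norm_add_sq_eq_norm_sq_add_norm_sq_of_inner_eq_zero _ _ h0
    rw [sub_add_sub_cancel] at this
    simpa only [sq] using this
  -- A preimage of the projection is a minimizer, which makes the `Classical.epsilon` choice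
  -- meaningful.
  obtain ⟨b, hb⟩ : ∃ b, Z.toEuclideanLin b = V.starProjection y := V.starProjection_apply_mem y
  have hmin : ∀ c, ‖y - Z.toEuclideanLin (lsEstimate Z y)‖ ^ 2 ≤ ‖y - Z.toEuclideanLin c‖ ^ 2 := by
    refine Classical.epsilon_spec (p := fun b : EuclideanSpace ℝ ι =>
      ∀ c : EuclideanSpace ℝ ι,
      ‖y - WithLp.toLp 2 (Z *ᵥ b.ofLp)‖ ^ 2 ≤ ‖y - WithLp.toLp 2 (Z *ᵥ c.ofLp)‖ ^ 2) ⟨b, fun c => ?_⟩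
    change ‖y - Z.toEuclideanLin b‖ ^ 2 ≤ ‖y - Z.toEuclideanLin c‖ ^ 2
    rw [hpyth b, hpyth c, hb, sub_self]
    simp
  have h := hmin b
  rw [hpyth, hpyth b, hb, sub_self] at h
  have h0 : ‖V.starProjection y - Z.toEuclideanLin (lsEstimate Z y)‖ ^ 2 = 0 :=
    le_antisymm (by simpa using h) (sq_nonneg _)
  rw [sq_eq_zero_iff, norm_eq_zero, sub_eq_zero] at h0
  exact h0.symm

lemma mul_norm_sq_le_norm_toEuclideanLin_sq [DecidableEq ι] {l : ℝ}
    (hZ : ∀ b : ι → ℝ, l * (b ⬝ᵥ b) ≤ (Z *ᵥ b) ⬝ᵥ (Z *ᵥ b)) (b : EuclideanSpace ℝ ι) :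
    l * ‖b‖ ^ 2 ≤ ‖Z.toEuclideanLin b‖ ^ 2 := by
  have h := hZ b.ofLp
  rw [← norm_toLp_sq, ← norm_toLp_sq] at h
  exact h

/-- The lower bound makes `Z` injective, so the chosen minimizer is unique and equals a linear left
inverse applied to the projection. -/
lemma measurable_lsEstimate {l : ℝ} (hl : 0 < l)
    (hZ : ∀ b : ι → ℝ, l * (b ⬝ᵥ b) ≤ (Z *ᵥ b) ⬝ᵥ (Z *ᵥ b)) : Measurable (lsEstimate Z) := by
  classical
  have hker : LinearMap.ker Z.toEuclideanLin = ⊥ := by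
    rw [LinearMap.ker_eq_bot']
    intro b hb
    have h := mul_norm_sq_le_norm_toEuclideanLin_sq hZ b
    rw [hb, norm_zero] at h
    have : ‖b‖ ^ 2 ≤ 0 := by nlinarith
    simpa using pow_eq_zero_iff two_ne_zero |>.1 (le_antisymm this (sq_nonneg _))
  obtain ⟨L, hL⟩ := LinearMap.exists_leftInverse_of_injective _ hker
  have h : lsEstimate Z = fun y => L ((LinearMap.range Z.toEuclideanLin).starProjection y) := by
    ext1 y
    rw [← toEuclideanLin_lsEstimate, ← LinearMap.comp_apply, hL, LinearMap.id_apply]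
  rw [h]
  exact (L.continuous_of_finiteDimensional.comp (ContinuousLinearMap.continuous _)).measurable

lemma norm_lsEstimate_sub_le [DecidableEq ι] {l : ℝ} (hl : 0 < l)
    (hZ : ∀ b : ι → ℝ, l * (b ⬝ᵥ b) ≤ (Z *ᵥ b) ⬝ᵥ (Z *ᵥ b))
    (b₀ : EuclideanSpace ℝ ι) (w : EuclideanSpace ℝ (Fin n))
    {z : ℝ} (hw : ‖(LinearMap.range Z.toEuclideanLin).orthogonalProjectionOnto w‖ ^ 2 ≤ z) :
    ‖lsEstimate Z (Z.toEuclideanLin b₀ + w) - b₀‖ ≤ √z / √l := by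
  have h := mul_norm_sq_le_norm_toEuclideanLin_sq hZ (lsEstimate Z (Z.toEuclideanLin b₀ + w) - b₀)
  rw [map_sub, toEuclideanLin_lsEstimate, map_add,
    Submodule.starProjection_eq_self_iff.2 (LinearMap.mem_range_self _ b₀), add_sub_cancel_left] at h
  rw [← Real.sqrt_div' _ hl.le]
  apply Real.le_sqrt_of_sq_le
  rw [le_div_iff₀ hl, mul_comm]
  exact h.trans hw

end LeastSquares

/-! ### Effect of replacing one row. -/

section Perturbation

variable {n p : ℕ} {B : ℝ} {X X' : Matrix (Fin n) (Fin p) ℝ}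

lemma eta_sq (hB : 0 < B) (hc : B < cMin X) : eta B X ^ 2 = B ^ 2 / (cMin X ^ 2 - B ^ 2) := by
  have : 0 < cMin X ^ 2 - B ^ 2 := by nlinarith
  exact Real.sq_sqrt (by positivity)

lemma eta_sq_mul (hB : 0 < B) (hc : B < cMin X) :
    eta B X ^ 2 * (cMin X ^ 2 - B ^ 2) = B ^ 2 := by
  have : 0 < cMin X ^ 2 - B ^ 2 := by nlinarith
  rw [eta_sq hB hc, div_mul_cancel₀ _ this.ne']

lemma div_eta (hB : 0 < B) : B / eta B X = √(cMin X ^ 2 - B ^ 2) := by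
  rw [eta, Real.sqrt_div (sq_nonneg B), Real.sqrt_sq hB.le, div_div_cancel₀ hB.ne']

/-- Replacing a single row changes the squared norm of a column by at most `B ^ 2`. -/
lemma colNorm_sq_le_of_eq_off_row {i : Fin n} (hX : ∀ k, k ≠ i → X k = X' k)
    (hrow : rowNorm X i ≤ B) (j : Fin p) : colNorm X j ^ 2 ≤ colNorm X' j ^ 2 + B ^ 2 := by
  have h1 : X i j ^ 2 ≤ B ^ 2 :=
    (sq_le_rowNorm_sq X i j).trans (pow_le_pow_left₀ (rowNorm_nonneg X i) hrow 2)
  rw [colNorm_sq, colNorm_sq, ← Finset.add_sum_erase _ _ (Finset.mem_univ i),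
    ← Finset.add_sum_erase (a := i) _ (fun k => X' k j ^ 2) (Finset.mem_univ i)]
  have h2 : ∑ k ∈ Finset.univ.erase i, X k j ^ 2 = ∑ k ∈ Finset.univ.erase i, X' k j ^ 2 :=
    Finset.sum_congr rfl fun k hk => by rw [hX k (Finset.ne_of_mem_erase hk)]
  rw [h2]
  nlinarith [sq_nonneg (X' i j)]

lemma abs_colNorm_sub_le (hp : 0 < p) (hA : Admissible B X) (hA' : Admissible B X') {i : Fin n}
    (hX : ∀ k, k ≠ i → X k = X' k) (hc : B < cMin X) (j : Fin p) :
    |colNorm X j - colNorm X' j| ≤ cMin X - B / eta B X := by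
  have hB := hA.pos hp
  have hcj := cMin_le X j
  have h1 := colNorm_sq_le_of_eq_off_row hX (hA.row_le i) j
  have h2 := colNorm_sq_le_of_eq_off_row (fun k hk => (hX k hk).symm) (hA'.row_le i) j
  have h0 := colNorm_nonneg X' j
  rw [div_eta hB]
  set m := cMin X
  set a := colNorm X j
  set b := colNorm X' j
  have hm : 0 < m ^ 2 - B ^ 2 := by nlinarith
  obtain ⟨r, hr⟩ : ∃ r, r = √(m ^ 2 - B ^ 2) := ⟨_, rfl⟩
  have hr0 : 0 ≤ r := hr ▸ Real.sqrt_nonneg _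
  have hr2 : r ^ 2 = m ^ 2 - B ^ 2 := hr ▸ Real.sq_sqrt hm.le
  rw [← hr, abs_le]
  have hrm : r ≤ m := by nlinarith
  constructor
  · nlinarith
  -- With `d = m - r`, `2 a d - d² ≥ 2 m d - d² = (m - r)(m + r) = B²`, hence `(a - d)² ≤ a² - B² ≤
  -- b²`.
  · have hkey : (a - (m - r)) ^ 2 ≤ b ^ 2 := by nlinarith
    have := abs_le.1 (abs_le_of_sq_le_sq hkey h0)
    linarith [this.2]

/-- The smallest eigenvalue of the normalized Gram matrix after replacing a single row. -/
lemma lamMin_gram_normalize_ge (hp : 0 < p) (hA : Admissible B X) (hA' : Admissible B X')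
    {i : Fin n} (hX : ∀ k, k ≠ i → X k = X' k) (hc : B < cMin X) (hη : eta B X ^ 2 < 1)
    (hl : 0 ≤ lamMin (gram (normalize X))) :
    (1 - eta B X ^ 2) * lamMin (gram (normalize X)) - eta B X ^ 2 ≤
      lamMin (gram (normalize X')) := by
  have hB := hA.pos hp
  set l := lamMin (gram (normalize X))
  refine le_lamMin hp (gram_isHermitian _) fun v => ?_
  rw [dotProduct_gram_mulVec]
  obtain ⟨u, rfl⟩ : ∃ u : Fin p → ℝ, v = fun j => colNorm X' j * u j :=
    ⟨fun j => v j / colNorm X' j, funext fun j => by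
      rw [mul_div_cancel₀ _ (hA'.colNorm_pos hp j).ne']⟩
  rw [hA'.normalize_mulVec_mul hp]
  have h1 := lamMin_mul_dotProduct_le (gram_isHermitian (normalize X))
    (fun j => colNorm X j * u j)
  rw [dotProduct_gram_mulVec, hA.normalize_mulVec_mul hp] at h1
  -- Only the replaced row matters: Cauchy–Schwarz bounds its old contribution, and its new one is
  -- nonnegative.
  have h2 : (X *ᵥ u) ⬝ᵥ (X *ᵥ u) ≤ (X' *ᵥ u) ⬝ᵥ (X' *ᵥ u) + B ^ 2 * (u ⬝ᵥ u) := by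
    have hcs : (X *ᵥ u) i ^ 2 ≤ B ^ 2 * (u ⬝ᵥ u) := by
      have h := Finset.sum_mul_sq_le_sq_mul_sq Finset.univ (X i) u
      rw [← rowNorm_sq] at h
      have hu : u ⬝ᵥ u = ∑ j, u j ^ 2 := by simp [dotProduct, sq]
      rw [hu]
      refine h.trans (mul_le_mul_of_nonneg_right ?_ (Finset.sum_nonneg fun _ _ => sq_nonneg _))
      exact pow_le_pow_left₀ (rowNorm_nonneg X i) (hA.row_le i) 2
    rw [dotProduct, dotProduct, ← Finset.add_sum_erase _ _ (Finset.mem_univ i),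
      ← Finset.add_sum_erase _ (fun k => (X' *ᵥ u) k * (X' *ᵥ u) k) (Finset.mem_univ i)]
    have h2 : ∑ k ∈ Finset.univ.erase i, (X *ᵥ u) k * (X *ᵥ u) k =
        ∑ k ∈ Finset.univ.erase i, (X' *ᵥ u) k * (X' *ᵥ u) k :=
      Finset.sum_congr rfl fun k hk => by
        rw [mulVec, mulVec, hX k (Finset.ne_of_mem_erase hk)]
    rw [h2]
    nlinarith [mul_self_nonneg ((X' *ᵥ u) i)]
  have h3 : ((1 - eta B X ^ 2) * l - eta B X ^ 2) *
      ((fun j => colNorm X' j * u j) ⬝ᵥ fun j => colNorm X' j * u j) ≤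
      l * ((fun j => colNorm X j * u j) ⬝ᵥ fun j => colNorm X j * u j) - B ^ 2 * (u ⬝ᵥ u) := by
    simp only [dotProduct, Finset.mul_sum]
    rw [← Finset.sum_sub_distrib]
    refine Finset.sum_le_sum fun j _ => ?_
    have hcj : cMin X ^ 2 ≤ colNorm X j ^ 2 :=
      pow_le_pow_left₀ (hB.trans hc).le (cMin_le X j) 2
    have e1 := colNorm_sq_le_of_eq_off_row hX (hA.row_le i) j
    have e2 := colNorm_sq_le_of_eq_off_row (fun k hk => (hX k hk).symm) (hA'.row_le i) j
    have e3 := eta_sq_mul hB hc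
    have e4 := sq_nonneg (eta B X)
    set q := eta B X ^ 2
    -- This is where `η` comes from: `η² (C_min² - B²) = B²`, and `C_min² - B²` bounds every new
    -- squared column norm from below.
    have f1 : B ^ 2 ≤ q * colNorm X' j ^ 2 := by
      rw [← e3]
      gcongr
      linarith
    have f2 : (1 - q) * colNorm X' j ^ 2 ≤ colNorm X j ^ 2 := by
      have g1 : (1 - q) * colNorm X' j ^ 2 ≤ (1 - q) * (colNorm X j ^ 2 + B ^ 2) :=
        mul_le_mul_of_nonneg_left e2 (by linarith)
      have g2 : q * (cMin X ^ 2 - B ^ 2) ≤ q * (colNorm X j ^ 2 + B ^ 2) :=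
        mul_le_mul_of_nonneg_left (by nlinarith) e4
      linarith
    have f3 : ((1 - q) * l - q) * colNorm X' j ^ 2 ≤ l * colNorm X j ^ 2 - B ^ 2 := by
      have := mul_le_mul_of_nonneg_left f2 hl
      linarith
    have := mul_le_mul_of_nonneg_right f3 (sq_nonneg (u j))
    linarith
  linarith

end Perturbation

/-! ### The deterministic sensitivity bound. -/

section Sensitivity

variable {n p : ℕ} {B : ℝ} {X : Matrix (Fin n) (Fin p) ℝ}
  {K : Matrix (Fin n) (Fin p) ℝ → Matrix (Fin n) (Fin p) ℝ}

/-- The coefficients of the normalized design with its knockoffs that correspond to `β`. -/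
noncomputable def scaledCoeff (X : Matrix (Fin n) (Fin p) ℝ) (β : EuclideanSpace ℝ (Fin p)) :
    EuclideanSpace ℝ (Fin p ⊕ Fin p) :=
  WithLp.toLp 2 (Sum.elim (fun j => colNorm X j * β j) 0)

lemma toEuclideanLin_scaledCoeff (hp : 0 < p) (hX : Admissible B X)
    (β : EuclideanSpace ℝ (Fin p)) (Xt : Matrix (Fin n) (Fin p) ℝ) :
    (fromCols (normalize X) Xt).toEuclideanLin (scaledCoeff X β) = WithLp.toLp 2 (X *ᵥ β.ofLp) := by
  change WithLp.toLp 2 (fromCols (normalize X) Xt *ᵥ Sum.elim (fun j => colNorm X j * β j) 0) = _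
  rw [fromCols_mulVec_sumElim, mulVec_zero, add_zero, hX.normalize_mulVec_mul hp]

lemma norm_scaledCoeff_sub_le {X' : Matrix (Fin n) (Fin p) ℝ} (β : EuclideanSpace ℝ (Fin p))
    {d : ℝ} (hd : 0 ≤ d) (h : ∀ j, |colNorm X j - colNorm X' j| ≤ d) :
    ‖scaledCoeff X β - scaledCoeff X' β‖ ≤ d * ‖β‖ := by
  refine le_of_sq_le_sq ?_ (by positivity)
  rw [mul_pow, EuclideanSpace.real_norm_sq_eq, EuclideanSpace.real_norm_sq_eq, Finset.mul_sum,
    Fintype.sum_sum_type]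
  simp only [scaledCoeff, PiLp.sub_apply, Sum.elim_inl, Sum.elim_inr, Pi.zero_apply, sub_self, ne_eq,
    OfNat.ofNat_ne_zero, not_false_eq_true, zero_pow, Finset.sum_const_zero, add_zero, ← sub_mul,
    mul_pow]
  refine Finset.sum_le_sum fun j _ => mul_le_mul_of_nonneg_right ?_ (sq_nonneg _)
  exact sq_le_sq' (by linarith [neg_abs_le (colNorm X j - colNorm X' j), h j])
    ((le_abs_self _).trans (h j))

lemma dotProduct_knockoffDesign_le (hp : 0 < p) (hK : IsKnockoffMap B K) (hX : Admissible B X)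
    (b : Fin p ⊕ Fin p → ℝ) : lamMin (gram (normalize X)) * (b ⬝ᵥ b) ≤
      (fromCols (normalize X) (K X) *ᵥ b) ⬝ᵥ (fromCols (normalize X) (K X) *ᵥ b) :=
  dotProduct_fromCols_mulVec_le (hX.isUnit_det_gram_normalize hp)
    (lamMin_mul_dotProduct_le (gram_isHermitian _)) (hK X hX) b

/-- The column space of the normalized design with its knockoffs. -/
noncomputable abbrev knockoffSpace (K : Matrix (Fin n) (Fin p) ℝ → Matrix (Fin n) (Fin p) ℝ)
    (X : Matrix (Fin n) (Fin p) ℝ) : Submodule ℝ (EuclideanSpace ℝ (Fin n)) :=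
  LinearMap.range (fromCols (normalize X) (K X)).toEuclideanLin

lemma finrank_knockoffSpace_le : Module.finrank ℝ (knockoffSpace K X) ≤ 2 * p := by
  refine (LinearMap.finrank_range_le _).trans_eq ?_
  simp [two_mul]

lemma norm_betaHat_sub_le (hp : 0 < p) (hK : IsKnockoffMap B K) (hX : Admissible B X)
    (β : EuclideanSpace ℝ (Fin p)) (w : EuclideanSpace ℝ (Fin n)) {m z : ℝ} (hm : 0 < m)
    (hml : m ≤ lamMin (gram (normalize X)))
    (hw : ‖(knockoffSpace K X).orthogonalProjectionOnto w‖ ^ 2 ≤ z) :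
    ‖betaHat K ⟨X, WithLp.toLp 2 (X *ᵥ β.ofLp) + w⟩ - scaledCoeff X β‖ ≤ √z / √m := by
  have h := norm_lsEstimate_sub_le (hm.trans_le hml) (dotProduct_knockoffDesign_le hp hK hX)
    (scaledCoeff X β) w hw
  rw [toEuclideanLin_scaledCoeff hp hX] at h
  refine h.trans ?_
  gcongr

lemma norm_betaHat_sub_betaHat_le (hp : 0 < p) (hK : IsKnockoffMap B K) (hX : Admissible B X)
    {X' : Matrix (Fin n) (Fin p) ℝ} (hX' : Admissible B X') {i : Fin n}
    (hXX' : ∀ k, k ≠ i → X k = X' k) (hB : B < cMin X) (hη : eta B X ^ 2 < 1)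
    (hlam : eta B X ^ 2 / (1 - eta B X ^ 2) < lamMin (gram (normalize X)))
    (β : EuclideanSpace ℝ (Fin p)) {w w' : EuclideanSpace ℝ (Fin n)} {σ δ₂ : ℝ}
    (hw : ‖(knockoffSpace K X).orthogonalProjectionOnto w‖ ^ 2 ≤ zeta p σ δ₂)
    (hw' : ‖(knockoffSpace K X').orthogonalProjectionOnto w'‖ ^ 2 ≤ zeta p σ δ₂) :
    ‖betaHat K ⟨X, WithLp.toLp 2 (X *ᵥ β.ofLp) + w⟩ -
      betaHat K ⟨X', WithLp.toLp 2 (X' *ᵥ β.ofLp) + w'⟩‖ ≤ sensitivity B σ δ₂ β X := by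
  have hη0 := sq_nonneg (eta B X)
  have h1η : 0 < 1 - eta B X ^ 2 := by linarith
  have hl : 0 < lamMin (gram (normalize X)) := lt_of_le_of_lt (by positivity) hlam
  rw [div_lt_iff₀ h1η] at hlam
  -- This number bounds the smallest eigenvalues of both normalized designs from below, so both
  -- noise terms get the same denominator.
  have hm : 0 < (1 - eta B X ^ 2) * lamMin (gram (normalize X)) - eta B X ^ 2 := by linarith
  have hml : (1 - eta B X ^ 2) * lamMin (gram (normalize X)) - eta B X ^ 2 ≤
      lamMin (gram (normalize X)) := by nlinarith
  have hml' := lamMin_gram_normalize_ge hp hX hX' hXX' hB hη hl.le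
  have h1 := norm_betaHat_sub_le hp hK hX β w hm hml hw
  have h2 := norm_betaHat_sub_le hp hK hX' β w' hm hml' hw'
  have hcol := abs_colNorm_sub_le hp hX hX' hXX' hB
  have h3 := norm_scaledCoeff_sub_le β ((abs_nonneg _).trans (hcol ⟨0, hp⟩)) hcol
  rw [sensitivity, mul_div_assoc]
  set a := betaHat K ⟨X, WithLp.toLp 2 (X *ᵥ β.ofLp) + w⟩
  set b := betaHat K ⟨X', WithLp.toLp 2 (X' *ᵥ β.ofLp) + w'⟩
  have e : a - b = (a - scaledCoeff X β) - (b - scaledCoeff X' β) +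
      (scaledCoeff X β - scaledCoeff X' β) := by abel
  rw [e]
  refine (norm_add_le _ _).trans (add_le_add ((norm_sub_le _ _).trans ?_) h3)
  linarith

end Sensitivity

/-! ### Randomness of the data and the noisy release. -/

section Mechanism

variable {n p : ℕ} {B σ : ℝ} {β : EuclideanSpace ℝ (Fin p)} {X : Matrix (Fin n) (Fin p) ℝ}
  {K : Matrix (Fin n) (Fin p) ℝ → Matrix (Fin n) (Fin p) ℝ}
  {Ω : Type*} [MeasurableSpace Ω] {P : Measure Ω} {A A' : Ω → Dataset n p}

lemma FollowsModel.aemeasurable_betaHat (hp : 0 < p) (hK : IsKnockoffMap B K)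
    (hA : FollowsModel P B σ β X A) (hl : 0 < lamMin (gram (normalize X))) :
    AEMeasurable (fun ω => betaHat K (A ω)) P := by
  obtain ⟨hX, w, hw, hAw⟩ := hA
  have h := measurable_lsEstimate hl (dotProduct_knockoffDesign_le hp hK hX)
  simp_rw [hAw]
  exact h.comp_aemeasurable (hw.aemeasurable.const_add _)

lemma measure_not_norm_betaHat_sub_le [IsProbabilityMeasure P] (hp : 0 < p)
    (hK : IsKnockoffMap B K) (hA : FollowsModel P B σ β X A) (hB : B < cMin X)
    (hη : eta B X ^ 2 < 1)
    (hlam : eta B X ^ 2 / (1 - eta B X ^ 2) < lamMin (gram (normalize X)))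
    {δ₂ : ℝ} (hδ₂ : 2 * Real.exp (-(p : ℝ) / 2) < δ₂)
    (hA' : A' ∈ modelData P B σ β) (hadj : AdjacentAE P A A') :
    P {ω | ¬ ‖betaHat K (A ω) - betaHat K (A' ω)‖ ≤ sensitivity B σ δ₂ β X} ≤
      ENNReal.ofReal δ₂ := by
  have hδpos : 0 < δ₂ := lt_trans (by positivity) hδ₂
  obtain ⟨hX, w, hw, hAw⟩ := hA
  obtain ⟨X', hX', w', hw', hAw'⟩ := hA'
  -- The designs are deterministic, so a single outcome fixes the row in which they differ.
  obtain ⟨ω₀, i, hi⟩ := hadj.exists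
  simp only [hAw, hAw'] at hi
  have htail : ∀ {Y : Matrix (Fin n) (Fin p) ℝ} {u : Ω → EuclideanSpace ℝ (Fin n)},
      HasLaw u (isoGaussian (Fin n) (σ ^ 2)) P →
      P {ω | zeta p σ δ₂ < ‖(knockoffSpace K Y).orthogonalProjectionOnto (u ω)‖ ^ 2} ≤
        ENNReal.ofReal (δ₂ / 2) := fun {Y u} hu => by
    rw [hu.measure_eq (p := fun x =>
      zeta p σ δ₂ < ‖(knockoffSpace K Y).orthogonalProjectionOnto x‖ ^ 2)
      (measurableSet_lt measurable_const (by fun_prop))]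
    exact isoGaussian_orthogonalProjection_tail hp hδ₂ _ finrank_knockoffSpace_le
  rw [← add_halves δ₂, ENNReal.ofReal_add (by positivity) (by positivity), add_halves]
  refine le_trans (measure_mono ?_) ((measure_union_le _ _).trans
    (add_le_add (htail (Y := X) hw) (htail (Y := X') hw')))
  intro ω hω
  by_contra hn
  simp only [Set.mem_union, Set.mem_ofPred_eq, not_or, not_lt] at hn
  refine hω ?_
  rw [hAw, hAw']
  exact norm_betaHat_sub_betaHat_le hp hK hX hX' (fun k hk => (hi k hk).1) hB hη hlam β hn.1 hn.2

lemma release_apply [IsProbabilityMeasure P] {v : ℝ}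
    (h : AEMeasurable (fun ω => betaHat K (A ω)) P)
    {S : Set (EuclideanSpace ℝ (Fin p ⊕ Fin p))} (hS : MeasurableSet S) :
    release P K v A S =
      ∫⁻ ω, isoGaussian (Fin p ⊕ Fin p) v {x | betaHat K (A ω) + x ∈ S} ∂P := by
  set ν := isoGaussian (Fin p ⊕ Fin p) v
  have hmap : release P K v A = (P.prod ν).map fun z => h.mk _ z.1 + z.2 := by
    refine Measure.map_congr ?_
    filter_upwards [Measure.quasiMeasurePreserving_fst.ae h.ae_eq_mk] with z hz
    rw [hz]
  have hm : Measurable fun z : Ω × EuclideanSpace ℝ (Fin p ⊕ Fin p) => h.mk _ z.1 + z.2 :=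
    (h.measurable_mk.comp measurable_fst).add measurable_snd
  rw [hmap, Measure.map_apply hm hS, Measure.prod_apply (hm hS)]
  refine lintegral_congr_ae ?_
  filter_upwards [h.ae_eq_mk] with ω hω
  rw [hω]
  rfl

/-- If two estimates are within the sensitivity outside an event of probability `δ₂`, then their
noisy releases satisfy the privacy inequality. -/
lemma release_le [IsProbabilityMeasure P] {ε δ₁ δ₂ Δ κ : ℝ} (hε : 0 < ε) (hε1 : ε < 1)
    (hδ₁ : 0 < δ₁) (hδ₁1 : δ₁ < 1) (hδ₂ : 0 ≤ δ₂)
    (hκ : 2 * Real.log (1.25 / δ₁) / ε ^ 2 * Δ ^ 2 < κ ^ 2)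
    (hA : AEMeasurable (fun ω => betaHat K (A ω)) P)
    (hA' : AEMeasurable (fun ω => betaHat K (A' ω)) P)
    (hbad : P {ω | ¬ ‖betaHat K (A ω) - betaHat K (A' ω)‖ ≤ Δ} ≤ ENNReal.ofReal δ₂)
    {S : Set (EuclideanSpace ℝ (Fin p ⊕ Fin p))} (hS : MeasurableSet S) :
    release P K (κ ^ 2) A S ≤ ENNReal.ofReal (Real.exp ε) * release P K (κ ^ 2) A' S +
      ENNReal.ofReal (δ₁ + δ₂) := by
  rw [release_apply hA hS, release_apply hA' hS]
  set ν := isoGaussian (Fin p ⊕ Fin p) (κ ^ 2)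
  -- A measurable hull of the bad event: same measure, and its indicator can be integrated.
  set N := toMeasurable P {ω | ¬ ‖betaHat K (A ω) - betaHat K (A' ω)‖ ≤ Δ} with hN
  have hNm : MeasurableSet N := measurableSet_toMeasurable _ _
  have hpt : ∀ ω, ν {x | betaHat K (A ω) + x ∈ S} ≤
      ENNReal.ofReal (Real.exp ε) * ν {x | betaHat K (A' ω) + x ∈ S} +
        (ENNReal.ofReal δ₁ + N.indicator 1 ω) := fun ω => by
    by_cases hω : ‖betaHat K (A ω) - betaHat K (A' ω)‖ ≤ Δ
    · rw [← add_assoc]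
      exact le_add_right (isoGaussian_preimage_add_le hε hε1 hδ₁ hδ₁1 hκ hω hS)
    · have : ω ∈ N := subset_toMeasurable _ _ hω
      rw [Set.indicator_of_mem this]
      exact le_add_left (le_add_left prob_le_one)
  refine (lintegral_mono hpt).trans ?_
  rw [lintegral_add_right _ (by fun_prop (disch := exact hNm)),
    lintegral_const_mul' _ _ ENNReal.ofReal_ne_top]
  refine add_le_add le_rfl ?_
  rw [lintegral_add_left measurable_const, lintegral_const, measure_univ, mul_one,
    lintegral_indicator_one hNm, hN, measure_toMeasurable, ENNReal.ofReal_add hδ₁.le hδ₂]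
  exact add_le_add le_rfl hbad

end Mechanism

end KnockoffDP

open KnockoffDP in
theorem theorem5 {n p : ℕ} (hp : 0 < p) (hnp : 2 * p ≤ n)
    (B σ : ℝ) (β : EuclideanSpace ℝ (Fin p))
    (ε δ₁ δ₂ : ℝ) (hε : 0 < ε ∧ ε < 1) (hδ₁ : 0 < δ₁ ∧ δ₁ < 1)
    (hδ₂ : 2 * Real.exp (-(p : ℝ) / 2) < δ₂)
    (K : Matrix (Fin n) (Fin p) ℝ → Matrix (Fin n) (Fin p) ℝ) (hK : IsKnockoffMap B K)
    {Ω : Type*} [MeasurableSpace Ω] (P : Measure Ω) [IsProbabilityMeasure P]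
    (X : Matrix (Fin n) (Fin p) ℝ) (A : Ω → Dataset n p) (hA : FollowsModel P B σ β X A)
    (hB : B < cMin X) (hη : eta B X ^ 2 < 1)
    (hlam : eta B X ^ 2 / (1 - eta B X ^ 2) < lamMin (gram (normalize X)))
    (κ : ℝ) (hκ : 2 * Real.log (1.25 / δ₁) / ε ^ 2 * sensitivity B σ δ₂ β X ^ 2 < κ ^ 2) :
    (∀ A' ∈ modelData P B σ β, AdjacentAE P A A' →
      ENNReal.ofReal (1 - δ₂) ≤
        P {ω | ‖betaHat K (A ω) - betaHat K (A' ω)‖ ≤ sensitivity B σ δ₂ β X}) ∧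
    DiffPrivateAt ε (δ₁ + δ₂) (modelData P B σ β) (AdjacentAE P) (release P K (κ ^ 2)) A := by
  have hδpos : 0 < δ₂ := lt_trans (by positivity) hδ₂
  have hbad : ∀ A' ∈ modelData P B σ β, AdjacentAE P A A' → _ := fun A' hA' hadj =>
    measure_not_norm_betaHat_sub_le hp hK hA hB hη hlam hδ₂ hA' hadj
  refine ⟨fun A' hA' hadj => ?_, fun A' hA' hadj S hS => ?_⟩
  · rw [ENNReal.ofReal_sub _ hδpos.le, ENNReal.ofReal_one, tsub_le_iff_right,
      ← measure_univ (μ := P)]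
    rw [← Set.union_compl_self {ω | ‖betaHat K (A ω) - betaHat K (A' ω)‖ ≤ sensitivity B σ δ₂ β X}]
    refine (measure_union_le _ _).trans ?_
    exact add_le_add le_rfl (hbad A' hA' hadj)
  · have hη0 := sq_nonneg (eta B X)
    have h1η : 0 < 1 - eta B X ^ 2 := by linarith
    have hl : 0 < lamMin (gram (normalize X)) := lt_of_le_of_lt (by positivity) hlam
    -- Positivity at the adjacent design ensures that its estimate is measurable too.
    have hl' : ∀ X', FollowsModel P B σ β X' A' → 0 < lamMin (gram (normalize X')) := by
      intro X' hX'
      obtain ⟨w, -, hAw⟩ := hA.2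
      obtain ⟨w', -, hAw'⟩ := hX'.2
      obtain ⟨ω₀, i, hi⟩ := hadj.exists
      simp only [hAw, hAw'] at hi
      refine lt_of_lt_of_le ?_ (lamMin_gram_normalize_ge hp hA.1 hX'.1 (fun k hk => (hi k hk).1)
        hB hη hl.le)
      rw [div_lt_iff₀ h1η] at hlam
      linarith
    have hm := hA.aemeasurable_betaHat hp hK hl
    have hm' : AEMeasurable (fun ω => betaHat K (A' ω)) P := by
      obtain ⟨X', hX'⟩ := hA'
      exact hX'.aemeasurable_betaHat hp hK (hl' X' hX')
    have h := hbad A' hA' hadj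
    refine ⟨release_le hε.1 hε.2 hδ₁.1 hδ₁.2 hδpos.le hκ hm hm' h hS,
      release_le hε.1 hε.2 hδ₁.1 hδ₁.2 hδpos.le hκ hm' hm ?_ hS⟩
    simp_rw [norm_sub_rev (betaHat K (A' _))]
    exact h
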